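/- Let $n,m,p\ge 0$ and let $\Sigma_\Lambda$: $\dot x(t)=A_\Lambda x(t)+B_\Lambda u(t)$, $y(t)=C_\Lambda x(t)$ be a linear structured system with $n$ states, $m$ inputs and $p$ outputs: each entry of $A_\Lambda\in\mathbb R^{n\times n}$, $B_\Lambda\in\mathbb R^{n\times m}$, $C_\Lambda\in\mathbb R^{p\times n}$ is either a fixed zero or a parameter of its own, and $\Lambda\in\mathbb R^k$ is the vector of these $k$ independent parameters. For real matrices $A,B,C$ of these sizes, the system $\dot x=Ax+Bu$, $y=Cx$ is called functionally output controllable if for every $T>0$ and every $C^\infty$ function $\tilde y:[0,T]\to\mathbb R^p$ with $\tilde y^{(j)}(0)=0$ for $0\le j\le n-1$ there is a $C^\infty$ input $u:[0,T]\to\mathbb R^m$ for which the output of the system with $x(0)=0$ satisfies $y(t)=\tilde y(t)$ for all $t\in[0,T]$. The structured system $\Sigma_\Lambda$ is generically functionally output controllable if $(A_\Lambda,B_\Lambda,C_\Lambda)$ is functionally output controllable for all $\Lambda\in\mathbb R^k$ outside some proper algebraic variety, i.e. outside the set of common zeros of some nonempty set of nonzero real polynomials in the $k$ parameters. Let $G(\Sigma_\Lambda)$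 be the directed graph with nodes $x_1,\dots,x_n$, $u_1,\dots,u_m$, $y_1,\dots,y_p$ and with the edges $(x_i,x_j)$, $(u_i,x_j)$, $(x_i,y_j)$ for those $i,j$ for which the $(j,i)$ entry of $A_\Lambda$, $B_\Lambda$, $C_\Lambda$, respectively, is not a fixed zero. An input-output linking is a set of simple directed paths in $G(\Sigma_\Lambda)$, each from an input node $u_i$ to an output node $y_j$, no two of which have a node in common; its size is the number of its paths. Then $\Sigma_\Lambda$ is generically functionally output controllable if and only if a maximum-size input-output linking in $G(\Sigma_\Lambda)$ has size $p$. -/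

import Mathlib

open scoped ContDiff

namespace StructuredSystems

/-! ### Linear systems and functional output controllability -/

/-- On the time interval `[0, T]`, the input `u` drives the system `x' = A x + B u`, `y = C x`
from the initial state `x 0 = 0` in such a way that the output is `y`. -/
def Produces {n m p : ℕ} (A : Matrix (Fin n) (Fin n) ℝ) (B : Matrix (Fin n) (Fin m) ℝ)
    (C : Matrix (Fin p) (Fin n) ℝ) (T : ℝ) (u : ℝ → Fin m → ℝ) (y : ℝ → Fin p → ℝ) : Prop :=
  ∃ x : ℝ → Fin n → ℝ, x 0 = 0 ∧
    (∀ t ∈ Set.Icc 0 T,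
      HasDerivWithinAt x (A.mulVec (x t) + B.mulVec (u t)) (Set.Icc 0 T) t) ∧
    ∀ t ∈ Set.Icc 0 T, C.mulVec (x t) = y t

/-- Functional output controllability: for every `T > 0`, every `C^∞` output trajectory on `[0, T]`
that starts at rest is the output, from `x 0 = 0`, for some `C^∞` input on `[0, T]`.

`x 0 = 0` forces `y 0 = 0`, and more generally it forces derivatives of the output at time `0` to
vanish up to an order that depends on the system and can be as large as `n - 1` (a chain of `n`
integrators), so that "starting at rest" has to be required of the trajectory: its derivatives of
order `0, 1, ..., n - 1` at time `0` vanish, where `n` is the number of states. -/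
def FunctionallyOutputControllable {n m p : ℕ} (A : Matrix (Fin n) (Fin n) ℝ)
    (B : Matrix (Fin n) (Fin m) ℝ) (C : Matrix (Fin p) (Fin n) ℝ) : Prop :=
  ∀ T : ℝ, 0 < T → ∀ y : ℝ → Fin p → ℝ, ContDiffOn ℝ ∞ y (Set.Icc 0 T) →
    (∀ j < n, iteratedDerivWithin j y (Set.Icc 0 T) 0 = 0) →
    ∃ u : ℝ → Fin m → ℝ, ContDiffOn ℝ ∞ u (Set.Icc 0 T) ∧ Produces A B C T u y

/-! ### Structured systems and genericity -/

/-- A linear structured system with `n` states, `m` inputs and `p` outputs: the positions of the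
entries of `A`, `B`, `C` that are not fixed zeros. -/
structure StructuredSystem (n m p : ℕ) where
  /-- the free positions (row, column) of `A` -/
  posA : Finset (Fin n × Fin n)
  /-- the free positions (row, column) of `B` -/
  posB : Finset (Fin n × Fin m)
  /-- the free positions (row, column) of `C` -/
  posC : Finset (Fin p × Fin n)

namespace StructuredSystem

variable {n m p : ℕ} (S : StructuredSystem n m p)

/-- The index set of the parameters: one independent parameter for each free position. -/
abbrev Param : Type := S.posA ⊕ S.posB ⊕ S.posC

/-- The state matrix for the parameter vector `Λ`. -/
noncomputable def matA (Λ : S.Param → ℝ) : Matrix (Fin n) (Fin n) ℝ :=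
  Matrix.of fun i j => if h : (i, j) ∈ S.posA then Λ (Sum.inl ⟨(i, j), h⟩) else 0

/-- The input matrix for the parameter vector `Λ`. -/
noncomputable def matB (Λ : S.Param → ℝ) : Matrix (Fin n) (Fin m) ℝ :=
  Matrix.of fun i j => if h : (i, j) ∈ S.posB then Λ (Sum.inr (Sum.inl ⟨(i, j), h⟩)) else 0

/-- The output matrix for the parameter vector `Λ`. -/
noncomputable def matC (Λ : S.Param → ℝ) : Matrix (Fin p) (Fin n) ℝ :=
  Matrix.of fun i j => if h : (i, j) ∈ S.posC then Λ (Sum.inr (Sum.inr ⟨(i, j), h⟩)) else 0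

end StructuredSystem

/-- A proper algebraic variety in the parameter space `ℝ^σ`: the set of common zeros of a nonempty
set of nonzero real polynomials. -/
def IsProperAlgebraicVariety {σ : Type*} (V : Set (σ → ℝ)) : Prop :=
  ∃ F : Set (MvPolynomial σ ℝ), F.Nonempty ∧ (∀ f ∈ F, f ≠ 0) ∧
    V = {Λ | ∀ f ∈ F, MvPolynomial.eval Λ f = 0}

/-- A property of the parameter vector is generic if it holds for all parameter vectors outside a
proper algebraic variety. -/
def IsGeneric {σ : Type*} (P : (σ → ℝ) → Prop) : Prop :=
  ∃ V : Set (σ → ℝ), IsProperAlgebraicVariety V ∧ ∀ Λ, Λ ∉ V → P Λ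

/-- The structured system is generically functionally output controllable. -/
def StructuredSystem.GenericallyFOC {n m p : ℕ} (S : StructuredSystem n m p) : Prop :=
  IsGeneric fun Λ : S.Param → ℝ =>
    FunctionallyOutputControllable (S.matA Λ) (S.matB Λ) (S.matC Λ)

/-! ### The graph of a structured system and linkings -/

/-- The nodes: states `x i`, inputs `u i`, outputs `y i`. -/
inductive Node (n m p : ℕ) : Type
  | x (i : Fin n) : Node n m p
  | u (i : Fin m) : Node n m p
  | y (i : Fin p) : Node n m p

namespace StructuredSystem

variable {n m p : ℕ} (S : StructuredSystem n m p)

/-- The edge relation: an edge goes from the node of the column to the node of the row of each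
free position of `A`, `B`, `C`. -/
def Edge : Node n m p → Node n m p → Prop
  | .x i, .x j => (j, i) ∈ S.posA
  | .u i, .x j => (j, i) ∈ S.posB
  | .x i, .y j => (j, i) ∈ S.posC
  | _, _ => False

/-- The directed graph of a structured system. -/
def graph : Digraph (Node n m p) where
  Adj := S.Edge

end StructuredSystem

/-- `l` lists the successive nodes of a simple direct path from `V₁` to `V₂`: consecutive nodes are
joined by edges, no node is repeated, the initial node is the only node of the path in `V₁`, and
the terminal node is the only node of the path in `V₂`. -/
structure IsSimpleDirectPath {V : Type*} (G : Digraph V) (V₁ V₂ : Set V) (l : List V) : Prop where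
  chain : l.IsChain G.Adj
  nodup : l.Nodup
  initial : ∃ v ∈ V₁, l.head? = some v ∧ ∀ w ∈ l, w ∈ V₁ → w = v
  terminal : ∃ v ∈ V₂, l.getLast? = some v ∧ ∀ w ∈ l, w ∈ V₂ → w = v

/-- A linking from `V₁` to `V₂`: a set of simple direct paths with no nodes in common. -/
def IsLinking {V : Type*} (G : Digraph V) (V₁ V₂ : Set V) (L : Finset (List V)) : Prop :=
  (∀ l ∈ L, IsSimpleDirectPath G V₁ V₂ l) ∧
    ∀ l ∈ L, ∀ l' ∈ L, l ≠ l' → List.Disjoint l l'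

/-- A linking of maximum size. -/
def IsMaximumLinking {V : Type*} (G : Digraph V) (V₁ V₂ : Set V) (L : Finset (List V)) : Prop :=
  IsLinking G V₁ V₂ L ∧ ∀ L' : Finset (List V), IsLinking G V₁ V₂ L' → L'.card ≤ L.card

/-- A maximum input-output linking in the graph of a structured system. -/
def StructuredSystem.IsMaximumInputOutputLinking {n m p : ℕ} (S : StructuredSystem n m p)
    (L : Finset (List (Node n m p))) : Prop :=
  IsMaximumLinking S.graph (Set.range Node.u) (Set.range Node.y) L

end StructuredSystems

/-!
Everything goes through the square matrix `M_J = [A - s I, B_J; C, 0]`, where `J` selects as many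
inputs as there are outputs: a system is functionally output controllable if and only if, for some
`J`, the polynomial `det M_J` in `s` is not zero, and this determinant sees the graph.

Suppose `det M_J ≠ 0` and let `y` be an output at rest. With `D` for differentiation, the equations
`D x = A x + B u`, `C x = y` read `M_J(D) (x, u) = (0, y)`. Cramer's rule solves them: take `z j` with
`(det M_J)(D) z j = y j` and apply to it the operators of the `j`-th output column of the adjugate
(`functionallyOutputControllable_of_det_ne_zero`). The scalar equation is solved over `ℂ` one linear
factor at a time, so that `z j` vanishes at `0` to order `n` if `y` does. As the operators that yield
the state have order less than `n`, this gives `x 0 = 0`.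

Suppose `det M_J = 0` for all `J`. Then the maximal minors of `C adj(s - A) B` vanish, so that
it has a nonzero polynomial row vector `w` in its left kernel. It follows that `w(D) y = 0` for all
outputs `y`, and `t ↦ t ^ N` in one channel with `N` large is not an output
(`exists_det_ne_zero_of_functionallyOutputControllable`).

A nonzero term of the Leibniz expansion of `det M_J` belongs to a permutation of the states and the
outputs. Its orbits, followed from each output index to the next one, are the disjoint paths of a
linking of size `p` (`exists_isLinking_of_det_ne_zero`). Conversely, set the parameters on the edges
of a linking of size `p` to `1` and the others to `0`. A row vector in the left kernel of `M_J` at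
`s = 1` is then constant along the paths and zero at their initial nodes, hence zero
(`det_linkingParam_ne_zero`). So `det M_J` at `s = 1` is a nonzero polynomial in the parameters, and
outside its zeros the system is functionally output controllable (`genericallyFOC_of_isLinking`).
-/

namespace StructuredSystems

open Polynomial

/-! ### Smooth functions as sequences of derivatives -/

section Shift
variable {𝕜 W : Type*} [Field 𝕜] [AddCommGroup W] [Module 𝕜 W]

/-- The shift `(f 0, f 1, …) ↦ (f 1, f 2, …)`. On the sequence of the successive derivatives of a
function it acts as differentiation. -/
abbrev shift (𝕜 W : Type*) [Field 𝕜] [AddCommGroup W] [Module 𝕜 W] : Module.End 𝕜 (ℕ → W) :=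
  LinearMap.funLeft 𝕜 W Nat.succ

theorem shift_pow_apply (i : ℕ) (f : ℕ → W) (k : ℕ) : (shift 𝕜 W ^ i) f k = f (k + i) := by
  induction i generalizing f with
  | zero => simp
  | succ i ih =>
    rw [pow_succ, Module.End.mul_apply, ih]
    rfl

theorem aeval_shift_apply (q : 𝕜[X]) (f : ℕ → W) (k : ℕ) :
    aeval (shift 𝕜 W) q f k = ∑ i ∈ Finset.range (q.natDegree + 1), q.coeff i • f (k + i) := by
  rw [aeval_eq_sum_range, LinearMap.sum_apply, Finset.sum_apply]
  refine Finset.sum_congr rfl fun i _ => ?_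
  rw [LinearMap.smul_apply, Pi.smul_apply, shift_pow_apply]

end Shift

/-- The sequences `f` of functions in which, on `[0, T]`, every term is the derivative of the term
before it. Such a sequence is a smooth function on `[0, T]` together with all its derivatives, and
differentiation is the shift. -/
def jets (𝕜 E : Type*) [NormedField 𝕜] [NormedAddCommGroup E] [NormedSpace 𝕜 E]
    [NormedSpace ℝ E] [SMulCommClass ℝ 𝕜 E] (T : ℝ) : Submodule 𝕜 (ℕ → ℝ → E) where
  carrier := {f | ∀ k, ∀ t ∈ Set.Icc 0 T, HasDerivWithinAt (f k) (f (k + 1) t) (Set.Icc 0 T) t}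
  add_mem' hf hg k t ht := (hf k t ht).add (hg k t ht)
  zero_mem' _ t _ := hasDerivWithinAt_const t _ 0
  smul_mem' c _ hf k t ht := (hf k t ht).const_smul c

section Jets
variable {𝕜 E : Type*} [NormedField 𝕜] [NormedAddCommGroup E] [NormedSpace 𝕜 E]
    [NormedSpace ℝ E] [SMulCommClass ℝ 𝕜 E] {T : ℝ}

theorem aeval_shift_mem_jets (q : 𝕜[X]) {f : ℕ → ℝ → E} (hf : f ∈ jets 𝕜 E T) :
    aeval (shift 𝕜 (ℝ → E)) q f ∈ jets 𝕜 E T := by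
  rw [aeval_eq_sum_range, LinearMap.sum_apply]
  refine Submodule.sum_mem _ fun i _ => Submodule.smul_mem _ _ fun k t ht => ?_
  rw [shift_pow_apply, shift_pow_apply, add_right_comm]
  exact hf _ t ht

end Jets

theorem contDiffOn_of_mem_jets {E : Type*} [NormedAddCommGroup E] [NormedSpace ℝ E] {T : ℝ}
    (hT : 0 < T) {f : ℕ → ℝ → E} (hf : f ∈ jets ℝ E T) (k : ℕ) :
    ContDiffOn ℝ ∞ (f k) (Set.Icc 0 T) := by
  rw [contDiffOn_infty]
  intro r
  induction r generalizing k with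
  | zero => exact contDiffOn_zero.2 fun t ht => (hf k t ht).continuousWithinAt
  | succ r ih =>
    have hu := uniqueDiffOn_Icc hT
    rw [Nat.cast_add, Nat.cast_one, contDiffOn_succ_iff_derivWithin hu]
    refine ⟨fun t ht => (hf k t ht).differentiableWithinAt, by simp, (ih (k + 1)).congr ?_⟩
    exact fun t ht => (hf k t ht).derivWithin (hu t ht)

theorem iteratedDerivWithin_mem_jets {E : Type*} [NormedAddCommGroup E] [NormedSpace ℝ E] {T : ℝ}
    (hT : 0 < T) {g : ℝ → E} (hg : ContDiffOn ℝ ∞ g (Set.Icc 0 T)) :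
    (fun k => iteratedDerivWithin k g (Set.Icc 0 T)) ∈ jets ℝ E T := by
  intro k t ht
  have hu := uniqueDiffOn_Icc hT
  have := hg.differentiableOn_iteratedDerivWithin (m := k)
    (by exact_mod_cast ENat.natCast_lt_top k) hu t ht
  simpa [iteratedDerivWithin_succ] using this.hasDerivWithinAt

/-- The first order equation `z' - c z = g`, solved by variation of constants. -/
theorem exists_jet_sub_smul {T : ℝ} (hT : 0 < T) (c : ℂ) {g : ℕ → ℝ → ℂ} (hg : g ∈ jets ℂ ℂ T)
    {N : ℕ} (h0 : ∀ k < N, g k 0 = 0) :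
    ∃ z ∈ jets ℂ ℂ T, (∀ k < N, z k 0 = 0) ∧ aeval (shift ℂ (ℝ → ℂ)) (X - C c) z = g := by
  have hcont : ContinuousOn (g 0) (Set.Icc 0 T) := fun t ht => (hg 0 t ht).continuousWithinAt
  set e : ℝ → ℂ := Set.IccExtend hT.le ((Set.Icc 0 T).domRestrict (g 0)) with he
  have hec : Continuous e := (continuousOn_iff_continuous_domRestrict.1 hcont).Icc_extend'
  have heq : ∀ t ∈ Set.Icc 0 T, e t = g 0 t := fun t ht => by
    rw [he, Set.IccExtend_of_mem _ _ ht]; rfl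
  set z0 : ℝ → ℂ := fun t => Complex.exp (c * t) * ∫ s in (0 : ℝ)..t, Complex.exp (-(c * s)) * e s
    with hz0
  have hder : ∀ t, HasDerivAt z0 (c * z0 t + e t) t := by
    intro t
    have h1 : HasDerivAt (fun t : ℝ => Complex.exp (c * t)) (Complex.exp (c * t) * (c * 1)) t :=
      ((Complex.ofRealCLM.hasDerivAt (x := t)).const_mul c).cexp
    have hc2 : Continuous fun s : ℝ => Complex.exp (-(c * s)) * e s := by fun_prop
    have h2 := hc2.integral_hasStrictDerivAt 0 t
    refine (h1.mul h2.hasDerivAt).congr_deriv ?_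
    have h3 : Complex.exp (c * t) * Complex.exp (-(c * t)) = 1 := by
      rw [← Complex.exp_add, add_neg_cancel, Complex.exp_zero]
    simp only [hz0]
    linear_combination e t * h3
  -- the higher derivatives are forced by the equation
  let z : ℕ → ℝ → ℂ := fun k => Nat.rec z0 (fun k f t => c * f t + g k t) k
  have hz : ∀ k t, z (k + 1) t = c * z k t + g k t := fun k t => rfl
  refine ⟨z, ?_, ?_, ?_⟩
  · intro k
    induction k with
    | zero =>
      intro t ht
      rw [hz, ← heq t ht]
      exact (hder t).hasDerivWithinAt
    | succ k ih =>
      intro t ht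
      exact ((ih t ht).const_mul c).add (hg k t ht)
  · intro k hk
    induction k with
    | zero => simp [z, hz0]
    | succ k ih => rw [hz, ih (by omega), h0 k (by omega)]; simp
  · funext k t
    have h1 : aeval (shift ℂ (ℝ → ℂ)) (X - C c) z = shift ℂ (ℝ → ℂ) z - c • z := by
      rw [map_sub, aeval_X, aeval_C, LinearMap.sub_apply, Module.algebraMap_end_apply]
    rw [h1]
    change z (k + 1) t - c * z k t = g k t
    rw [hz]; ring

/-- Over `ℂ`, the operator `d(D)` is a product of first order operators. -/
theorem exists_complex_jet_aeval_eq {T : ℝ} (hT : 0 < T) {d : ℂ[X]} (hd : d ≠ 0)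
    {g : ℕ → ℝ → ℂ} (hg : g ∈ jets ℂ ℂ T) {N : ℕ} (h0 : ∀ k < N, g k 0 = 0) :
    ∃ z ∈ jets ℂ ℂ T, (∀ k < N, z k 0 = 0) ∧ aeval (shift ℂ (ℝ → ℂ)) d z = g := by
  induction hr : d.natDegree generalizing d g with
  | zero =>
    rw [eq_C_of_natDegree_eq_zero hr] at hd ⊢
    set a := d.coeff 0
    have ha : a ≠ 0 := fun h => hd (by rw [h, C_0])
    refine ⟨a⁻¹ • g, Submodule.smul_mem _ _ hg, fun k hk => by simp [h0 k hk], ?_⟩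
    rw [aeval_C, Module.algebraMap_end_apply, smul_inv_smul₀ ha]
  | succ r ih =>
    obtain ⟨c, hc⟩ := IsAlgClosed.exists_root d (by
      rw [degree_eq_natDegree hd, hr]; exact_mod_cast r.succ_ne_zero)
    obtain ⟨q, rfl⟩ := dvd_iff_isRoot.2 hc
    have hq : q ≠ 0 := right_ne_zero_of_mul hd
    obtain ⟨w, hw, hw0, hwe⟩ := exists_jet_sub_smul hT c hg h0
    obtain ⟨z, hz, hz0, hze⟩ := ih hq hw hw0 (by
      rw [natDegree_mul (X_sub_C_ne_zero c) hq, natDegree_X_sub_C] at hr; omega)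
    exact ⟨z, hz, hz0, by rw [map_mul, Module.End.mul_apply, hze, hwe]⟩

/-- A scalar equation `d(D) z = g` with constant real coefficients has a solution that vanishes at
`0` to the order of `g`. -/
theorem exists_jet_aeval_eq {T : ℝ} (hT : 0 < T) {d : ℝ[X]} (hd : d ≠ 0)
    {g : ℕ → ℝ → ℝ} (hg : g ∈ jets ℝ ℝ T) {N : ℕ} (h0 : ∀ k < N, g k 0 = 0) :
    ∃ z ∈ jets ℝ ℝ T, (∀ k < N, z k 0 = 0) ∧ aeval (shift ℝ (ℝ → ℝ)) d z = g := by
  obtain ⟨z, hz, hz0, hze⟩ := exists_complex_jet_aeval_eq hT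
    (d := d.map (algebraMap ℝ ℂ)) (by simpa [Polynomial.map_eq_zero] using hd)
    (g := fun k t => (g k t : ℂ)) (fun k t ht => (hg k t ht).ofReal_comp) (N := N)
    (fun k hk => by simp [h0 k hk])
  refine ⟨fun k t => (z k t).re, fun k t ht => ?_, fun k hk => by simp [hz0 k hk], ?_⟩
  · exact Complex.reCLM.hasFDerivAt.comp_hasDerivWithinAt t (hz k t ht)
  · funext k t
    have h := congrArg Complex.re (congrFun (congrFun hze k) t)
    rw [aeval_shift_apply] at h ⊢
    simpa [natDegree_map, Finset.sum_apply] using h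

/-! ### The system matrix and the construction of inputs -/

section

/-- The system matrix `[A - s I, B_J; C, 0]`, where `B_J` is made of the columns `J 0, J 1, …` of
`B`. It is square, since as many inputs are selected as there are outputs. -/
def systemMatrix {n m p : ℕ} {R : Type*} [CommRing R] (A : Matrix (Fin n) (Fin n) R)
    (B : Matrix (Fin n) (Fin m) R) (C : Matrix (Fin p) (Fin n) R) (J : Fin p → Fin m) (s : R) :
    Matrix (Fin n ⊕ Fin p) (Fin n ⊕ Fin p) R :=
  Matrix.fromBlocks (A - Matrix.scalar (Fin n) s) (B.submatrix id J) C 0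

theorem systemMatrix_map {n m p : ℕ} {R R' : Type*} [CommRing R] [CommRing R'] (f : R →+* R')
    (A : Matrix (Fin n) (Fin n) R) (B : Matrix (Fin n) (Fin m) R) (C : Matrix (Fin p) (Fin n) R)
    (J : Fin p → Fin m) (s : R) :
    f (systemMatrix A B C J s).det = (systemMatrix (A.map f) (B.map f) (C.map f) J (f s)).det := by
  rw [RingHom.map_det]
  congr 1
  ext (i | i) (j | j)
  · simp [systemMatrix, Matrix.diagonal_apply, apply_ite f]
  all_goals simp [systemMatrix]

/-- The system matrix over `ℝ[X]`, with `s` the indeterminate. -/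
noncomputable def systemPencil {n m p : ℕ} (A : Matrix (Fin n) (Fin n) ℝ)
    (B : Matrix (Fin n) (Fin m) ℝ) (C : Matrix (Fin p) (Fin n) ℝ) (J : Fin p → Fin m) :
    Matrix (Fin n ⊕ Fin p) (Fin n ⊕ Fin p) ℝ[X] :=
  systemMatrix (A.map Polynomial.C) (B.map Polynomial.C) (C.map Polynomial.C) J X

theorem natDegree_det_le_sum {ι R : Type*} [Fintype ι] [DecidableEq ι] [CommRing R]
    (M : Matrix ι ι R[X]) (b : ι → ℕ) (h : ∀ i j, (M i j).natDegree ≤ b j) :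
    M.det.natDegree ≤ ∑ j, b j := by
  rw [Matrix.det_apply]
  refine natDegree_sum_le_of_forall_le _ _ fun σ _ => ?_
  refine (natDegree_smul_le _ _).trans ((natDegree_prod_le _ _).trans ?_)
  exact Finset.sum_le_sum fun j _ => h _ j

variable {n m p : ℕ} {A : Matrix (Fin n) (Fin n) ℝ} {B : Matrix (Fin n) (Fin m) ℝ}
  {C : Matrix (Fin p) (Fin n) ℝ} {J : Fin p → Fin m}

/-- In Cramer's rule the column of `x i` is replaced by a constant one, and so only the other
`n - 1` state columns contribute to the degree. -/
theorem natDegree_cramer_systemPencil_lt (i : Fin n) (j : Fin n ⊕ Fin p) :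
    ((systemPencil A B C J).cramer (Pi.single j 1) (Sum.inl i)).natDegree < n := by
  rw [Matrix.cramer_apply]
  have hn : 0 < n := i.pos
  have hle := natDegree_det_le_sum
    ((systemPencil A B C J).updateCol (Sum.inl i) (Pi.single j 1))
    (Sum.elim (fun k => if k = i then 0 else 1) fun _ => 0) (by
      intro r c
      rcases eq_or_ne c (Sum.inl i) with rfl | hc
      · rcases eq_or_ne r j with rfl | hr <;> simp [*]
      · rw [Matrix.updateCol_ne hc]
        rcases c with c | c
        · have hci : c ≠ i := fun h => hc (by rw [h])
          rcases r with r | r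
          · simp only [systemPencil, systemMatrix, Matrix.fromBlocks_apply₁₁, Matrix.sub_apply,
              Matrix.map_apply, Matrix.scalar_apply, Matrix.diagonal_apply, Sum.elim_inl, hci,
              if_false]
            refine (natDegree_sub_le _ _).trans (max_le (by simp) ?_)
            split_ifs <;> simp
          · simp [systemPencil, systemMatrix]
        · rcases r with r | r <;> simp [systemPencil, systemMatrix])
  refine hle.trans_lt ?_
  simp only [Fintype.sum_sum_type, Sum.elim_inl, Sum.elim_inr, Finset.sum_const_zero, add_zero]
  calc (∑ k : Fin n, if k = i then 0 else 1) < ∑ _k : Fin n, 1 :=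
        Finset.sum_lt_sum (fun k _ => by split_ifs <;> simp) ⟨i, Finset.mem_univ _, by simp⟩
    _ = n := by simp

/-- Cramer's rule for the system matrix, read as an identity of differential operators, provides
an input for every output at rest. -/
theorem functionallyOutputControllable_of_det_ne_zero (h : (systemPencil A B C J).det ≠ 0) :
    FunctionallyOutputControllable A B C := by
  intro T hT y hy hy0
  have hyj : ∀ j, (fun k t => iteratedDerivWithin k y (Set.Icc 0 T) t j) ∈ jets ℝ ℝ T :=
    fun j k t ht => (hasDerivWithinAt_pi.1 (iteratedDerivWithin_mem_jets hT hy k t ht)) j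
  choose z hz hz0 hze using fun j => exists_jet_aeval_eq hT h (hyj j) (N := n)
    (fun k hk => by rw [hy0 k hk]; rfl)
  set D := shift ℝ (ℝ → ℝ)
  let c : Fin p → Fin n ⊕ Fin p → ℝ[X] := fun j =>
    (systemPencil A B C J).cramer (Pi.single (Sum.inr j) 1)
  let ξ : Fin n ⊕ Fin p → ℕ → ℝ → ℝ := fun i => ∑ j, aeval D (c j i) (z j)
  have hξ : ∀ i, ξ i ∈ jets ℝ ℝ T := fun i =>
    Submodule.sum_mem _ fun j _ => aeval_shift_mem_jets _ (hz j)
  -- the behavioural equations, row by row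
  have key : ∀ i, ∑ l, aeval D (systemPencil A B C J i l) (ξ l) =
      Sum.elim (fun _ => 0) (fun j k t => iteratedDerivWithin k y (Set.Icc 0 T) t j) i := by
    intro i
    have h1 : ∀ j, ∑ l, aeval D (systemPencil A B C J i l) (aeval D (c j l) (z j)) =
        if i = Sum.inr j then (fun k t => iteratedDerivWithin k y (Set.Icc 0 T) t j) else 0 := by
      intro j
      have h2 := congrFun ((systemPencil A B C J).mulVec_cramer (Pi.single (Sum.inr j) 1)) i
      have h3 : ∑ l, aeval D (systemPencil A B C J i l) (aeval D (c j l) (z j)) =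
          aeval D (∑ l, systemPencil A B C J i l * c j l) (z j) := by
        simp [map_sum, LinearMap.sum_apply]
      rw [h3]
      have h4 : ∑ l, systemPencil A B C J i l * c j l =
          (systemPencil A B C J).det * (Pi.single (Sum.inr j) 1 : Fin n ⊕ Fin p → ℝ[X]) i := h2
      rw [h4]
      split_ifs with hij
      · rw [hij, Pi.single_eq_same, mul_one, hze]
      · rw [Pi.single_eq_of_ne hij, mul_zero, map_zero, LinearMap.zero_apply]
    simp only [ξ, map_sum]
    rw [Finset.sum_comm, Finset.sum_congr rfl fun j _ => h1 j]
    rcases i with i | i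
    · simp
    · simp
  have hstate : ∀ i k t, ξ (Sum.inl i) (k + 1) t =
      ∑ l, A i l * ξ (Sum.inl l) k t + ∑ j, B i (J j) * ξ (Sum.inr j) k t := by
    intro i k t
    have h1 := congrFun (congrFun (key (Sum.inl i)) k) t
    have h2 : ∀ l, aeval D (systemPencil A B C J (Sum.inl i) (Sum.inl l)) (ξ (Sum.inl l)) k t =
        A i l * ξ (Sum.inl l) k t - if i = l then ξ (Sum.inl l) (k + 1) t else 0 := by
      intro l
      simp only [systemPencil, systemMatrix, Matrix.fromBlocks_apply₁₁, Matrix.sub_apply,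
        Matrix.map_apply, Matrix.scalar_apply, Matrix.diagonal_apply]
      split_ifs
      · rw [map_sub, aeval_X, aeval_C]; rfl
      · rw [sub_zero, sub_zero, aeval_C]; rfl
    have h3 : ∀ j, aeval D (systemPencil A B C J (Sum.inl i) (Sum.inr j)) (ξ (Sum.inr j)) k t =
        B i (J j) * ξ (Sum.inr j) k t := by
      intro j
      simp only [systemPencil, systemMatrix, Matrix.fromBlocks_apply₁₂, Matrix.submatrix_apply,
        Matrix.map_apply, aeval_C]
      rfl
    rw [Fintype.sum_sum_type] at h1
    simp only [Pi.add_apply, Finset.sum_apply, h2, h3, Finset.sum_sub_distrib, Finset.sum_ite_eq,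
      Finset.mem_univ, if_true, Sum.elim_inl, Pi.zero_apply] at h1
    linarith
  have houtput : ∀ i t, ∑ l, C i l * ξ (Sum.inl l) 0 t = y t i := by
    intro i t
    have h1 := congrFun (congrFun (key (Sum.inr i)) 0) t
    have h2 : ∀ l, aeval D (systemPencil A B C J (Sum.inr i) (Sum.inl l)) (ξ (Sum.inl l)) 0 t =
        C i l * ξ (Sum.inl l) 0 t := by
      intro l
      simp only [systemPencil, systemMatrix, Matrix.fromBlocks_apply₂₁, Matrix.map_apply, aeval_C]
      rfl
    have h3 : ∀ j, aeval D (systemPencil A B C J (Sum.inr i) (Sum.inr j)) (ξ (Sum.inr j)) 0 t =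
        0 := by
      intro j
      simp [systemPencil, systemMatrix]
    rw [Fintype.sum_sum_type] at h1
    simpa only [Pi.add_apply, Finset.sum_apply, h2, h3, Finset.sum_const_zero, add_zero,
      Sum.elim_inr, iteratedDerivWithin_zero] using h1
  refine ⟨fun t l => ∑ j, if J j = l then ξ (Sum.inr j) 0 t else 0, ?_,
    fun t i => ξ (Sum.inl i) 0 t, ?_, ?_, ?_⟩
  · refine contDiffOn_pi.2 fun l => ContDiffOn.sum fun j _ => ?_
    split_ifs
    · exact contDiffOn_of_mem_jets hT (hξ _) 0
    · exact contDiffOn_const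
  · funext i
    simp only [ξ, Finset.sum_apply, Pi.zero_apply, D]
    refine Finset.sum_eq_zero fun j _ => ?_
    rw [aeval_shift_apply, Finset.sum_apply]
    refine Finset.sum_eq_zero fun k hk => ?_
    have hlt : k < n := by
      have := natDegree_cramer_systemPencil_lt (A := A) (B := B) (C := C) (J := J) i (Sum.inr j)
      have := Finset.mem_range.1 hk
      simp only [c] at this
      omega
    rw [Pi.smul_apply, zero_add, hz0 j k hlt, smul_zero]
  · intro t ht
    refine hasDerivWithinAt_pi.2 fun i => (hξ (Sum.inl i) 0 t ht).congr_deriv ?_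
    rw [hstate]
    simp only [Pi.add_apply, Matrix.mulVec, dotProduct]
    congr 1
    simp only [Finset.mul_sum, mul_ite, mul_zero]
    rw [Finset.sum_comm]
    simp
  · intro t _
    funext i
    exact houtput i t

end

/-! ### The differential equation of the outputs of a singular system -/

section

theorem jets_eqOn {E : Type*} [NormedAddCommGroup E] [NormedSpace ℝ E] {T : ℝ} (hT : 0 < T)
    {f g : ℕ → ℝ → E} (hf : f ∈ jets ℝ E T) (hg : g ∈ jets ℝ E T)
    (h0 : Set.EqOn (f 0) (g 0) (Set.Icc 0 T)) (k : ℕ) : Set.EqOn (f k) (g k) (Set.Icc 0 T) := by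
  induction k with
  | zero => exact h0
  | succ k ih =>
    intro t ht
    exact (uniqueDiffOn_Icc hT t ht).eq_deriv _ (hf k t ht)
      ((hg k t ht).congr (fun s hs => ih hs) (ih ht))

/-- A matrix with vanishing maximal minors has a nonzero row vector in its left kernel. -/
theorem exists_vecMul_eq_zero_of_minors {R : Type*} [CommRing R] [IsDomain R] {p m : ℕ}
    (G : Matrix (Fin p) (Fin m) R) (h : ∀ J : Fin p → Fin m, (G.submatrix id J).det = 0) :
    ∃ w : Fin p → R, w ≠ 0 ∧ Matrix.vecMul w G = 0 := by
  by_contra! hcon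
  set K := FractionRing R
  set G' := G.map (algebraMap R K)
  have hR : LinearIndependent R G'.row := by
    rw [Fintype.linearIndependent_iff]
    intro w hw
    by_contra! hne
    refine hcon w (fun h0 => ?_) (funext fun l => ?_)
    · obtain ⟨i, hi⟩ := hne
      exact hi (congrFun h0 i)
    · apply IsFractionRing.injective R K
      have := congrFun hw l
      simpa [Matrix.vecMul, dotProduct, G', Finset.sum_apply, Algebra.smul_def] using this
  have hK : LinearIndependent K G'.row := (LinearIndependent.iff_fractionRing R K).1 hR
  have hrank := hK.rank_matrix
  rw [Matrix.rank_eq_finrank_span_cols, Fintype.card_fin] at hrank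
  obtain ⟨f, hf, hli⟩ : ∃ f : Fin p → Fin p → K,
      (∀ i, f i ∈ Set.range G'.col) ∧ LinearIndependent K f := by
    obtain ⟨f, hf, -, hli⟩ := Submodule.exists_fun_fin_finrank_span_eq K (Set.range G'.col)
    exact ⟨f ∘ Fin.cast hrank.symm, fun i => hf _, hli.comp _ (Fin.cast_injective _)⟩
  choose J hJ using hf
  have hcol : (G'.submatrix id J).col = f := by
    funext i
    rw [← hJ i]
    rfl
  have hunit := Matrix.linearIndependent_cols_iff_isUnit.1 (hcol ▸ hli)
  refine ((Matrix.isUnit_iff_isUnit_det _).1 hunit).ne_zero ?_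
  have := congrArg (algebraMap R K) (h J)
  rw [RingHom.map_det, map_zero] at this
  exact this

variable {n m p : ℕ} {A : Matrix (Fin n) (Fin n) ℝ} {B : Matrix (Fin n) (Fin m) ℝ}
  {C : Matrix (Fin p) (Fin n) ℝ}

/-- The transfer matrix `C (X - A)⁻¹ B` multiplied by `det (X - A)`, which makes it polynomial. -/
noncomputable def transferNumerator (A : Matrix (Fin n) (Fin n) ℝ) (B : Matrix (Fin n) (Fin m) ℝ)
    (C : Matrix (Fin p) (Fin n) ℝ) : Matrix (Fin p) (Fin m) ℝ[X] :=
  C.map Polynomial.C * A.charmatrix.adjugate * B.map Polynomial.C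

/-- The Schur complement of the state block of the system matrix, with denominators cleared. -/
theorem det_transferNumerator_submatrix_eq_zero {J : Fin p → Fin m}
    (h : (systemPencil A B C J).det = 0) : ((transferNumerator A B C).submatrix id J).det = 0 := by
  set BJ := (B.map Polynomial.C).submatrix id J
  have hsub : (transferNumerator A B C).submatrix id J =
      C.map Polynomial.C * A.charmatrix.adjugate * BJ := rfl
  have hmul : systemPencil A B C J *
      Matrix.fromBlocks A.charmatrix.adjugate (A.charmatrix.adjugate * BJ) 0
        (A.charpoly • (1 : Matrix (Fin p) (Fin p) ℝ[X])) =
      Matrix.fromBlocks (-(A.charpoly • (1 : Matrix (Fin n) (Fin n) ℝ[X]))) 0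
        (C.map Polynomial.C * A.charmatrix.adjugate)
        ((transferNumerator A B C).submatrix id J) := by
    have h1 : A.map Polynomial.C - Matrix.scalar (Fin n) X = -A.charmatrix := by
      rw [Matrix.charmatrix, neg_sub]; rfl
    have h2 : A.charmatrix * A.charmatrix.adjugate = A.charpoly • 1 := Matrix.mul_adjugate _
    rw [systemPencil, systemMatrix, Matrix.fromBlocks_multiply, h1, hsub]
    congr 1
    · rw [Matrix.neg_mul, h2, Matrix.mul_zero, add_zero]
    · rw [Matrix.neg_mul, ← Matrix.mul_assoc, h2]
      simp [BJ]
    · simp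
    · simp [Matrix.mul_assoc]
  have hdet := congrArg Matrix.det hmul
  rw [Matrix.det_mul, h, zero_mul, Matrix.det_fromBlocks_zero₁₂, Matrix.det_neg,
    Matrix.det_smul] at hdet
  have hc : A.charpoly ≠ 0 := A.charpoly_monic.ne_zero
  simpa [hc] using hdet.symm

theorem sum_aeval_vecMul {a b : Type*} [Fintype a] [Fintype b] {W : Type*} [AddCommGroup W]
    [Module ℝ W] (D : Module.End ℝ W) (v : a → ℝ[X]) (M : Matrix a b ℝ[X]) (f : b → W) :
    ∑ l, aeval D (Matrix.vecMul v M l) (f l) =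
      ∑ i, aeval D (v i) (∑ l, aeval D (M i l) (f l)) := by
  simp only [Matrix.vecMul, dotProduct, map_sum, LinearMap.sum_apply, map_mul,
    Module.End.mul_apply]
  rw [Finset.sum_comm]

/-- A constant-coefficient operator of order at most `N` does not annihilate `t ↦ t ^ N`. -/
theorem exists_aeval_shift_monomial_ne_zero {q : ℝ[X]} (hq : q ≠ 0) {N : ℕ}
    (hN : q.natDegree ≤ N) :
    ∃ t ∈ Set.Icc (0 : ℝ) 1,
      aeval (shift ℝ ℝ) q (fun k => (derivative^[k] (X ^ N : ℝ[X])).eval t) 0 ≠ 0 := by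
  by_contra! hcon
  set r : ℝ[X] := ∑ k ∈ Finset.range (q.natDegree + 1),
    Polynomial.C (q.coeff k) * derivative^[k] (X ^ N : ℝ[X]) with hr
  have hr0 : r = 0 := by
    refine eq_zero_of_infinite_isRoot r ((Set.Icc_infinite zero_lt_one).mono fun t ht => ?_)
    have := hcon t ht
    rw [aeval_shift_apply] at this
    simpa [hr, IsRoot, eval_finsetSum] using this
  have hcoeff := congrArg (fun s => s.coeff (N - q.natDegree)) hr0
  simp only [hr, finsetSum_coeff, coeff_zero] at hcoeff
  rw [Finset.sum_eq_single q.natDegree] at hcoeff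
  · rw [iterate_derivative_X_pow_eq_C_mul, coeff_C_mul, coeff_C_mul, coeff_X_pow, if_pos rfl,
      mul_one] at hcoeff
    rcases mul_eq_zero.1 hcoeff with h | h
    · exact hq (leadingCoeff_eq_zero.1 h)
    · exact (Nat.descFactorial_pos.2 hN).ne' (by exact_mod_cast h)
  · intro k hk hne
    have := Finset.mem_range.1 hk
    rw [iterate_derivative_X_pow_eq_C_mul, coeff_C_mul, coeff_C_mul, coeff_X_pow,
      if_neg (by omega), mul_zero, mul_zero]
  · simp

/-- If the transfer matrix has rank less than `p`, then all outputs satisfy one and the same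
nontrivial differential equation. -/
theorem exists_operator_annihilating_outputs
    (h : ∀ J : Fin p → Fin m, (systemPencil A B C J).det = 0) :
    ∃ (w : Fin p → ℝ[X]) (v : Fin n → ℝ[X]), w ≠ 0 ∧
      Matrix.vecMul v A.charmatrix = Matrix.vecMul w (C.map Polynomial.C) ∧
      Matrix.vecMul v (B.map Polynomial.C) = 0 := by
  obtain ⟨w, hw, hwG⟩ := exists_vecMul_eq_zero_of_minors (transferNumerator A B C)
    fun J => det_transferNumerator_submatrix_eq_zero (h J)
  refine ⟨A.charpoly • w, Matrix.vecMul w (C.map Polynomial.C * A.charmatrix.adjugate), ?_, ?_, ?_⟩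
  · exact smul_ne_zero A.charpoly_monic.ne_zero hw
  · rw [Matrix.vecMul_vecMul, Matrix.mul_assoc, Matrix.adjugate_mul, Matrix.mul_smul,
      Matrix.mul_one, Matrix.vecMul_smul, Matrix.smul_vecMul]
    rfl
  · rw [Matrix.vecMul_vecMul]
    exact hwG

theorem exists_det_ne_zero_of_functionallyOutputControllable
    (hfoc : FunctionallyOutputControllable A B C) :
    ∃ J : Fin p → Fin m, (systemPencil A B C J).det ≠ 0 := by
  by_contra! hcon
  obtain ⟨w, v, hw, hvA, hvB⟩ := exists_operator_annihilating_outputs hcon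
  obtain ⟨i₀, hi₀⟩ := Function.ne_iff.1 hw
  set N := n + (w i₀).natDegree with hN
  obtain ⟨t, ht, hne⟩ := exists_aeval_shift_monomial_ne_zero hi₀ (N := N) (by omega)
  -- the output `t ^ N` in the channel `i₀`, zero in the other channels, with its derivatives
  let Y : ℕ → ℝ → Fin p → ℝ := fun k t =>
    Pi.single i₀ ((derivative^[k] (X ^ N : ℝ[X])).eval t)
  have hYd : ∀ k t, HasDerivAt (Y k) (Y (k + 1) t) t := by
    intro k t
    refine hasDerivAt_pi.2 fun i => ?_
    rcases eq_or_ne i i₀ with rfl | hi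
    · simp only [Y, Pi.single_eq_same, Function.iterate_succ_apply']
      exact Polynomial.hasDerivAt _ _
    · simp only [Y, Pi.single_eq_of_ne hi]
      exact hasDerivAt_const _ _
  have hY : Y ∈ jets ℝ (Fin p → ℝ) 1 := fun k t _ => (hYd k t).hasDerivWithinAt
  have hYc : ContDiffOn ℝ ∞ (Y 0) (Set.Icc 0 1) := contDiffOn_of_mem_jets one_pos hY 0
  obtain ⟨u, hu, x, -, hx, hxy⟩ := hfoc 1 one_pos (Y 0) hYc (by
    intro j hj
    rw [jets_eqOn one_pos (iteratedDerivWithin_mem_jets one_pos hYc) hY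
      (fun t _ => by rw [iteratedDerivWithin_zero]) j (Set.left_mem_Icc.2 zero_le_one)]
    simp only [Y]
    rw [iterate_derivative_X_pow_eq_C_mul, eval_mul, eval_pow, eval_X, zero_pow (by omega),
      mul_zero, Pi.single_zero])
  -- the derivatives of the state, from those of the input
  let U : ℕ → ℝ → Fin m → ℝ := fun k => iteratedDerivWithin k u (Set.Icc 0 1)
  have hU : U ∈ jets ℝ (Fin m → ℝ) 1 := iteratedDerivWithin_mem_jets one_pos hu
  let Z : ℕ → ℝ → Fin n → ℝ := fun k =>
    Nat.rec x (fun k f t => A.mulVec (f t) + B.mulVec (U k t)) k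
  have hZs : ∀ k t, Z (k + 1) t = A.mulVec (Z k t) + B.mulVec (U k t) := fun _ _ => rfl
  have hZ : Z ∈ jets ℝ (Fin n → ℝ) 1 := by
    intro k
    induction k with
    | zero =>
      intro t ht
      rw [hZs]
      simpa [U, Z] using hx t ht
    | succ k ih =>
      intro t ht
      exact ((A.mulVecLin.toContinuousLinearMap.hasFDerivAt.comp_hasDerivWithinAt t
        (ih t ht)).add (B.mulVecLin.toContinuousLinearMap.hasFDerivAt.comp_hasDerivWithinAt t
        (hU k t ht)))
  have hCZ : (fun k t => C.mulVec (Z k t)) ∈ jets ℝ (Fin p → ℝ) 1 := fun k t ht =>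
    C.mulVecLin.toContinuousLinearMap.hasFDerivAt.comp_hasDerivWithinAt t (hZ k t ht)
  have hCY : ∀ k, C.mulVec (Z k t) = Y k t := fun k =>
    jets_eqOn one_pos hCZ hY (fun s hs => hxy s hs) k ht
  set D := shift ℝ ℝ
  have hstate : ∀ i, ∑ l, aeval D (A.charmatrix i l) (fun k => Z k t l) =
      ∑ l, aeval D (B.map Polynomial.C i l) (fun k => U k t l) := by
    intro i
    have h1 : ∀ l, aeval D (A.charmatrix i l) (fun k => Z k t l) =
        (if i = l then D (fun k => Z k t l) else 0) - A i l • fun k => Z k t l := by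
      intro l
      rw [Matrix.charmatrix_apply, Matrix.diagonal_apply]
      split_ifs <;> simp
    funext k
    have h2 := congrFun (hZs k t) i
    have h3 : ∀ l, (if i = l then D (fun k => Z k t l) else 0 : ℕ → ℝ) k =
        if i = l then Z (k + 1) t l else 0 := fun l => by split_ifs <;> rfl
    simp only [h1, Matrix.map_apply, aeval_C, Module.algebraMap_end_apply, Finset.sum_sub_distrib,
      Pi.sub_apply, Finset.sum_apply, Pi.smul_apply, smul_eq_mul, h3, Finset.sum_ite_eq,
      Finset.mem_univ, if_true]
    rw [h2]
    simp [Matrix.mulVec, dotProduct]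
  have hout : ∀ i, ∑ l, aeval D (C.map Polynomial.C i l) (fun k => Z k t l) =
      fun k => Y k t i := by
    intro i
    funext k
    rw [← hCY k]
    simp [Matrix.mulVec, dotProduct]
  have hann : ∑ i, aeval D (w i) (fun k => Y k t i) = 0 := by
    simp only [← hout]
    rw [← sum_aeval_vecMul, ← hvA, sum_aeval_vecMul]
    simp only [hstate]
    rw [← sum_aeval_vecMul, hvB]
    simp
  apply hne
  have h1 := congrFun hann 0
  rw [Finset.sum_eq_single i₀] at h1
  · simpa only [Y, Pi.single_eq_same, Pi.zero_apply] using h1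
  · intro i _ hi
    simp only [Y, Pi.single_eq_of_ne hi]
    exact map_zero _
  · simp

end

/-! ### From linkings to determinants -/

section

variable {n m p : ℕ} {S : StructuredSystem n m p}

/-- `b` follows `a` on one of the paths of the linking `L`. -/
def Follows {V : Type*} (L : Finset (List V)) (a b : V) : Prop :=
  ∃ l ∈ L, ∃ i, l[i]? = some a ∧ l[i + 1]? = some b

theorem Follows.right_unique {V : Type*} {G : Digraph V} {V₁ V₂ : Set V} {L : Finset (List V)}
    (hL : IsLinking G V₁ V₂ L) {a b c : V} (hb : Follows L a b) (hc : Follows L a c) : b = c := by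
  obtain ⟨l, hl, i, hia, hib⟩ := hb
  obtain ⟨l', hl', j, hja, hjc⟩ := hc
  obtain rfl : l = l' := by
    by_contra hne
    exact hL.2 l hl l' hl' hne (List.mem_of_getElem? hia) (List.mem_of_getElem? hja)
  obtain rfl : i = j := by
    obtain ⟨hi, hi'⟩ := List.getElem?_eq_some_iff.1 hia
    obtain ⟨hj, hj'⟩ := List.getElem?_eq_some_iff.1 hja
    exact ((hL.1 l hl).nodup.getElem_inj_iff).1 (hi'.trans hj'.symm)
  exact Option.some.inj (hib.symm.trans hjc)

theorem Follows.adj {V : Type*} {G : Digraph V} {V₁ V₂ : Set V} {L : Finset (List V)}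
    (hL : IsLinking G V₁ V₂ L) {a b : V} (h : Follows L a b) : G.Adj a b := by
  obtain ⟨l, hl, i, hia, hib⟩ := h
  obtain ⟨hi, rfl⟩ := List.getElem?_eq_some_iff.1 hia
  obtain ⟨hj, rfl⟩ := List.getElem?_eq_some_iff.1 hib
  exact (List.isChain_iff_getElem.1 (hL.1 l hl).chain) i hj

/-- The parameter vector that equals `1` on the edges of the linking and `0` elsewhere. -/
noncomputable def linkingParam (S : StructuredSystem n m p) (L : Finset (List (Node n m p))) :
    S.Param → ℝ := by
  classical
  exact Sum.elim (fun e => if Follows L (.x e.1.2) (.x e.1.1) then 1 else 0)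
    (Sum.elim (fun e => if Follows L (.u e.1.2) (.x e.1.1) then 1 else 0)
      (fun e => if Follows L (.x e.1.2) (.y e.1.1) then 1 else 0))

section
open Classical
variable {L : Finset (List (Node n m p))}

theorem matA_linkingParam (hL : IsLinking S.graph (Set.range Node.u) (Set.range Node.y) L)
    (i j : Fin n) : S.matA (linkingParam S L) i j = if Follows L (.x j) (.x i) then 1 else 0 := by
  have h : Follows L (.x j) (.x i) → (i, j) ∈ S.posA := fun h => h.adj hL
  by_cases hf : Follows L (.x j) (.x i) <;> simp [StructuredSystem.matA, linkingParam, hf]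
  exact h hf

theorem matB_linkingParam (hL : IsLinking S.graph (Set.range Node.u) (Set.range Node.y) L)
    (i : Fin n) (j : Fin m) :
    S.matB (linkingParam S L) i j = if Follows L (.u j) (.x i) then 1 else 0 := by
  have h : Follows L (.u j) (.x i) → (i, j) ∈ S.posB := fun h => h.adj hL
  by_cases hf : Follows L (.u j) (.x i) <;> simp [StructuredSystem.matB, linkingParam, hf]
  exact h hf

theorem matC_linkingParam (hL : IsLinking S.graph (Set.range Node.u) (Set.range Node.y) L)
    (i : Fin p) (j : Fin n) :
    S.matC (linkingParam S L) i j = if Follows L (.x j) (.y i) then 1 else 0 := by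
  have h : Follows L (.x j) (.y i) → (i, j) ∈ S.posC := fun h => h.adj hL
  by_cases hf : Follows L (.x j) (.y i) <;> simp [StructuredSystem.matC, linkingParam, hf]
  exact h hf

/-- A sum over all nodes that may follow `a` has at most one term. -/
theorem sum_follows_eq (hL : IsLinking S.graph (Set.range Node.u) (Set.range Node.y) L)
    (val : Node n m p → ℝ) {a b : Node n m p} (hb : Follows L a b) :
    ∑ i, val (.x i) * (if Follows L a (.x i) then 1 else 0) +
      ∑ j, val (.y j) * (if Follows L a (.y j) then 1 else 0) = val b := by
  have hiff : ∀ c, Follows L a c ↔ c = b :=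
    fun c => ⟨fun h => h.right_unique hL hb, fun h => h ▸ hb⟩
  simp only [hiff]
  have hadj : S.Edge a b := hb.adj hL
  rcases b with i | i | i
  · simp
  · rcases a with _ | _ | _ <;> exact hadj.elim
  · simp

end

/-- Assigning to each path its terminal output is injective, as the paths are disjoint. -/
theorem exists_injective_terminal {L : Finset (List (Node n m p))}
    (hL : IsLinking S.graph (Set.range Node.u) (Set.range Node.y) L) :
    ∃ e : L → Fin p, Function.Injective e ∧ ∀ l, Node.y (e l) ∈ l.1 := by
  choose t ht using fun l : L => (hL.1 l.1 l.2).terminal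
  choose e he using fun l => (ht l).1
  have hmem : ∀ l : L, Node.y (e l) ∈ l.1 := fun l => by
    rw [he]; exact List.mem_of_getLast? (ht l).2.1
  refine ⟨e, fun l l' h => ?_, hmem⟩
  by_contra hne
  exact hL.2 l.1 l.2 l'.1 l'.2 (fun h' => hne (Subtype.ext h')) (hmem l) (h ▸ hmem l')

theorem card_le_of_isLinking {L : Finset (List (Node n m p))}
    (hL : IsLinking S.graph (Set.range Node.u) (Set.range Node.y) L) : L.card ≤ p := by
  obtain ⟨e, he, -⟩ := exists_injective_terminal hL
  simpa using Fintype.card_le_of_injective e he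

/-- On the parameter vector of a linking, a row vector in the left kernel of `[A - I, B_J; C, 0]` is
constant along every path, and it vanishes at the initial node. -/
theorem det_linkingParam_ne_zero {L : Finset (List (Node n m p))}
    (hL : IsLinking S.graph (Set.range Node.u) (Set.range Node.y) L) (hcard : L.card = p) :
    ∃ J : Fin p → Fin m, (systemMatrix (S.matA (linkingParam S L)) (S.matB (linkingParam S L))
      (S.matC (linkingParam S L)) J 1).det ≠ 0 := by
  classical
  obtain ⟨e, he, hend⟩ := exists_injective_terminal hL
  obtain ⟨g, hge, hg⟩ := Function.bijective_iff_has_inverse.1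
    ((Fintype.bijective_iff_injective_and_card e).2 ⟨he, by simp [hcard]⟩)
  let path : Fin p → List (Node n m p) := fun j => (g j).1
  have hpath : ∀ j, path j ∈ L := fun j => (g j).2
  have hy : ∀ j, Node.y j ∈ path j := fun j => by
    have := hend (g j)
    rwa [hg j] at this
  have hpath_of_mem : ∀ l ∈ L, ∃ j, path j = l := fun l hl =>
    ⟨e ⟨l, hl⟩, congrArg Subtype.val (hge ⟨l, hl⟩)⟩
  choose v hv using fun j => (hL.1 _ (hpath j)).initial
  choose J hJ using fun j => (hv j).1
  refine ⟨J, fun hdet => ?_⟩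
  obtain ⟨ξ, hξ, hker⟩ := Matrix.exists_vecMul_eq_zero_iff.2 hdet
  let val : Node n m p → ℝ
    | .x i => ξ (Sum.inl i)
    | .u _ => 0
    | .y j => ξ (Sum.inr j)
  have hstate : ∀ i, ∑ k, val (.x k) * (if Follows L (.x i) (.x k) then 1 else 0) +
      ∑ j, val (.y j) * (if Follows L (.x i) (.y j) then 1 else 0) = val (.x i) := by
    intro i
    have h := congrFun hker (Sum.inl i)
    simp only [Matrix.vecMul, dotProduct, Fintype.sum_sum_type, systemMatrix,
      Matrix.fromBlocks_apply₁₁, Matrix.fromBlocks_apply₂₁, Matrix.sub_apply, mul_sub,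
      Finset.sum_sub_distrib, matA_linkingParam hL, matC_linkingParam hL, Matrix.scalar_apply,
      Matrix.diagonal_apply, Pi.zero_apply] at h
    have h1 : ∑ k, ξ (Sum.inl k) * (if k = i then (1 : ℝ) else 0) = ξ (Sum.inl i) := by simp
    rw [h1] at h
    simp only [val]
    linarith
  have hinput : ∀ j, ∑ k, val (.x k) * (if Follows L (.u (J j)) (.x k) then 1 else 0) = 0 := by
    intro j
    have h := congrFun hker (Sum.inr j)
    simpa only [Matrix.vecMul, dotProduct, Fintype.sum_sum_type, systemMatrix,
      Matrix.fromBlocks_apply₁₂, Matrix.fromBlocks_apply₂₂, Matrix.submatrix_apply, id_eq,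
      matB_linkingParam hL, Matrix.zero_apply, mul_zero, Finset.sum_const_zero, add_zero,
      Pi.zero_apply] using h
  have hpres : ∀ (j : Fin p) (i : ℕ) (a b : Node n m p), (path j)[i]? = some a →
      (path j)[i + 1]? = some b → val b = val a := by
    intro j i a b ha hb
    have hf : Follows L a b := ⟨_, hpath j, i, ha, hb⟩
    have hadj : S.Edge a b := hf.adj hL
    rcases a with a | a | a
    · rw [← sum_follows_eq hL val hf, hstate]
    · rcases b with b | b | b
      · have ha' : Node.u a = v j := (hv j).2.2 _ (List.mem_of_getElem? ha) ⟨a, rfl⟩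
        rw [← hJ j] at ha'
        rw [Node.u.inj ha'] at hf ⊢
        have h1 := sum_follows_eq hL val hf
        rw [hinput] at h1
        have h2 : ∀ k, ¬ Follows L (.u (J j)) (Node.y k) := fun k h => (h.adj hL).elim
        simpa [h2, val] using h1.symm
      all_goals exact hadj.elim
    · exact hadj.elim
  have hzero : ∀ (j : Fin p) (i : ℕ) (a : Node n m p), (path j)[i]? = some a → val a = 0 := by
    intro j i
    induction i with
    | zero =>
      intro a ha
      have := (hv j).2.1
      rw [List.head?_eq_getElem?, ha, Option.some.injEq, ← hJ j] at this
      rw [this]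
    | succ i ih =>
      intro b hb
      obtain ⟨hi, -⟩ := List.getElem?_eq_some_iff.1 hb
      have ha : (path j)[i]? = some (path j)[i] := List.getElem?_eq_getElem (by omega)
      rw [hpres j i _ _ ha hb, ih _ ha]
  have hfollows : ∀ a b, Follows L a b → val b = 0 := by
    rintro a b ⟨l, hl, i, -, hb⟩
    obtain ⟨j, rfl⟩ := hpath_of_mem l hl
    exact hzero j _ _ hb
  refine hξ (funext fun r => ?_)
  rcases r with i | j
  · change val (.x i) = 0
    rw [← hstate]
    rw [Finset.sum_eq_zero, Finset.sum_eq_zero, add_zero]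
    · intro j _
      split_ifs with h
      · rw [hfollows _ _ h, zero_mul]
      · rw [mul_zero]
    · intro j _
      split_ifs with h
      · rw [hfollows _ _ h, zero_mul]
      · rw [mul_zero]
  · obtain ⟨i, hi, h⟩ := List.getElem_of_mem (hy j)
    exact hzero j i (.y j) (by rw [List.getElem?_eq_getElem hi, h])

/-- The determinant of `[A - I, B_J; C, 0]` is a polynomial in the parameters, which does not vanish
at the parameter vector of the linking. -/
theorem genericallyFOC_of_isLinking {L : Finset (List (Node n m p))}
    (hL : IsLinking S.graph (Set.range Node.u) (Set.range Node.y) L) (hcard : L.card = p) :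
    S.GenericallyFOC := by
  obtain ⟨J, hJ⟩ := det_linkingParam_ne_zero hL hcard
  let A : Matrix (Fin n) (Fin n) (MvPolynomial S.Param ℝ) := Matrix.of fun i j =>
    if h : (i, j) ∈ S.posA then MvPolynomial.X (Sum.inl ⟨(i, j), h⟩) else 0
  let B : Matrix (Fin n) (Fin m) (MvPolynomial S.Param ℝ) := Matrix.of fun i j =>
    if h : (i, j) ∈ S.posB then MvPolynomial.X (Sum.inr (Sum.inl ⟨(i, j), h⟩)) else 0
  let C : Matrix (Fin p) (Fin n) (MvPolynomial S.Param ℝ) := Matrix.of fun i j =>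
    if h : (i, j) ∈ S.posC then MvPolynomial.X (Sum.inr (Sum.inr ⟨(i, j), h⟩)) else 0
  have heval : ∀ Λ, MvPolynomial.eval Λ (systemMatrix A B C J 1).det =
      (systemMatrix (S.matA Λ) (S.matB Λ) (S.matC Λ) J 1).det := by
    intro Λ
    rw [systemMatrix_map, map_one]
    congr 2
    all_goals
      ext i j
      simp only [A, B, C, Matrix.map_apply, Matrix.of_apply, StructuredSystem.matA,
        StructuredSystem.matB, StructuredSystem.matC]
      split_ifs <;> simp
  refine ⟨_, ⟨{(systemMatrix A B C J 1).det}, Set.singleton_nonempty _, ?_, rfl⟩, ?_⟩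
  · rintro _ rfl h
    apply hJ
    rw [← heval, h, map_zero]
  · intro Λ hΛ
    refine functionallyOutputControllable_of_det_ne_zero (J := J) fun h => hΛ ?_
    rintro _ rfl
    -- the pencil at `X = 1`
    have h1 := systemMatrix_map (evalRingHom (1 : ℝ)) ((S.matA Λ).map Polynomial.C)
      ((S.matB Λ).map Polynomial.C) ((S.matC Λ).map Polynomial.C) J X
    rw [← systemPencil, h, map_zero] at h1
    rw [heval, h1]
    congr 2 <;> first | (ext i j; simp) | simp

end

/-! ### From determinants to linkings -/

section

variable {n m p : ℕ} {S : StructuredSystem n m p}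

/-- The node of a row of the system matrix. -/
def rowNode (m : ℕ) : Fin n ⊕ Fin p → Node n m p :=
  Sum.elim Node.x Node.y

theorem rowNode_injective (m : ℕ) :
    Function.Injective (rowNode m : Fin n ⊕ Fin p → Node n m p) := by
  rintro (i | i) (j | j) h <;> simp_all [rowNode]

/-- The walk along the orbit of the input column `j` under the permutation `σ` of the indices: it
starts at the selected input `u (J j)` and goes on through the rows `σ j, σ² j, …`. -/
def orbitNode (σ : Equiv.Perm (Fin n ⊕ Fin p)) (J : Fin p → Fin m) (j : Fin p) (a : ℕ) :
    Node n m p :=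
  if a = 0 then .u (J j) else rowNode m ((σ ^ a) (Sum.inr j))

section
variable (σ : Equiv.Perm (Fin n ⊕ Fin p))

theorem exists_return (j : Fin p) : ∃ k, 0 < k ∧ ((σ ^ k) (Sum.inr j)).isRight :=
  ⟨orderOf σ, orderOf_pos σ, by rw [pow_orderOf_eq_one]; rfl⟩

/-- The time of the first return to the indices of the outputs. -/
noncomputable def returnTime (j : Fin p) : ℕ :=
  Nat.find (exists_return σ j)

theorem returnTime_pos (j : Fin p) : 0 < returnTime σ j :=
  (Nat.find_spec (exists_return σ j)).1

theorem isRight_returnTime (j : Fin p) : ((σ ^ returnTime σ j) (Sum.inr j)).isRight :=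
  (Nat.find_spec (exists_return σ j)).2

theorem returnTime_le {j : Fin p} {k : ℕ} (hk : 0 < k) {i : Fin p}
    (h : (σ ^ k) (Sum.inr j) = Sum.inr i) : returnTime σ j ≤ k :=
  Nat.find_min' _ ⟨hk, by rw [h]; rfl⟩

variable {σ} {J : Fin p → Fin m}

/-- Orbit segments up to the first return do not meet, neither themselves nor one another. -/
theorem orbitNode_inj (hJ : Function.Injective J) {i j : Fin p} {a b : ℕ}
    (ha : a ≤ returnTime σ i) (hb : b ≤ returnTime σ j)
    (h : orbitNode σ J i a = orbitNode σ J j b) : i = j ∧ a = b := by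
  wlog hab : a ≤ b generalizing i j a b
  · exact (this hb ha h.symm (le_of_not_ge hab)).imp Eq.symm Eq.symm
  unfold orbitNode at h
  rcases Nat.eq_zero_or_pos a with rfl | ha0
  · rw [if_pos rfl] at h
    split_ifs at h with hb0
    · exact ⟨hJ (Node.u.inj h), hb0.symm⟩
    · rcases hr : (σ ^ b) (Sum.inr j) with r | r <;> simp [hr, rowNode] at h
  · rw [if_neg (by omega), if_neg (by omega)] at h
    have h1 := rowNode_injective m h
    rw [← Nat.add_sub_cancel' hab, pow_add, Equiv.Perm.mul_apply, EmbeddingLike.apply_eq_iff_eq]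
      at h1
    rcases Nat.eq_zero_or_pos (b - a) with h0 | h0
    · rw [h0, pow_zero, Equiv.Perm.one_apply] at h1
      exact ⟨Sum.inr_injective h1, by omega⟩
    · have := returnTime_le σ h0 h1.symm
      omega

variable {Λ : S.Param → ℝ}

/-- A nonzero entry off the diagonal of the state block is the parameter of an edge from the node of
its column to the node of its row. -/
theorem edge_of_ne_zero
    (hσ : ∀ c, systemPencil (S.matA Λ) (S.matB Λ) (S.matC Λ) J (σ c) c ≠ 0)
    {j : Fin p} {a : ℕ} (ha : a < returnTime σ j) :
    S.Edge (orbitNode σ J j a) (orbitNode σ J j (a + 1)) := by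
  have hnext : orbitNode σ J j (a + 1) = rowNode m (σ ((σ ^ a) (Sum.inr j))) := by
    rw [orbitNode, if_neg a.succ_ne_zero, pow_succ', Equiv.Perm.mul_apply]
  have hne := hσ ((σ ^ a) (Sum.inr j))
  rw [hnext]
  rcases Nat.eq_zero_or_pos a with rfl | ha0
  · rw [pow_zero, Equiv.Perm.one_apply] at hne ⊢
    rcases hr : σ (Sum.inr j) with r | r
    · by_contra hcon
      have hcon : (r, J j) ∉ S.posB := hcon
      rw [hr] at hne
      simp [systemPencil, systemMatrix, StructuredSystem.matB, hcon] at hne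
    · rw [hr] at hne
      simp [systemPencil, systemMatrix] at hne
  · rcases hq : (σ ^ a) (Sum.inr j) with q | q
    · rw [orbitNode, if_neg ha0.ne', hq]
      rw [hq] at hne
      rcases hr : σ (Sum.inl q) with r | r
      · by_contra hcon
        have hcon : (r, q) ∉ S.posA := hcon
        -- a diagonal entry `- X` belongs to a fixed point of `σ`, which is not on the orbit
        have hrq : r ≠ q := by
          rintro rfl
          have h1 : (σ ^ a) (Sum.inl r) = Sum.inl r :=
            Equiv.Perm.pow_apply_eq_self_of_apply_eq_self hr a
          rw [← h1, EmbeddingLike.apply_eq_iff_eq] at hq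
          cases hq
        rw [hr] at hne
        simp [systemPencil, systemMatrix, StructuredSystem.matA, hcon, hrq] at hne
      · by_contra hcon
        have hcon : (r, q) ∉ S.posC := hcon
        rw [hr] at hne
        simp [systemPencil, systemMatrix, StructuredSystem.matC, hcon] at hne
    · have := returnTime_le σ ha0 hq
      omega

theorem isSimpleDirectPath_orbit (hJ : Function.Injective J)
    (hσ : ∀ c, systemPencil (S.matA Λ) (S.matB Λ) (S.matC Λ) J (σ c) c ≠ 0) (j : Fin p) :
    IsSimpleDirectPath S.graph (Set.range Node.u) (Set.range Node.y)
      ((List.range (returnTime σ j + 1)).map (orbitNode σ J j)) := by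
  constructor
  · rw [List.isChain_iff_getElem]
    intro a ha
    simp only [List.length_map, List.length_range] at ha
    simp only [List.getElem_map, List.getElem_range]
    exact edge_of_ne_zero hσ (by omega)
  · refine List.Nodup.map_on (fun a ha b hb h => ?_) List.nodup_range
    rw [List.mem_range] at ha hb
    exact (orbitNode_inj hJ (by omega) (by omega) h).2
  · refine ⟨_, ⟨J j, rfl⟩, by simp [List.head?_range, orbitNode], ?_⟩
    rintro _ hw ⟨i, rfl⟩
    obtain ⟨a, -, ha⟩ := List.mem_map.1 hw
    unfold orbitNode at ha
    split_ifs at ha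
    · exact ha.symm
    · rcases hr : (σ ^ a) (Sum.inr j) with r | r <;> simp [hr, rowNode] at ha
  · obtain ⟨r, hr⟩ := Sum.isRight_iff.1 (isRight_returnTime σ j)
    have hlast : orbitNode σ J j (returnTime σ j) = Node.y r := by
      rw [orbitNode, if_neg (returnTime_pos σ j).ne', hr]
      rfl
    refine ⟨_, ⟨r, rfl⟩, by simp [List.getLast?_range, hlast], ?_⟩
    rintro _ hw ⟨i, rfl⟩
    obtain ⟨a, ha, hai⟩ := List.mem_map.1 hw
    rw [List.mem_range] at ha
    have hle : returnTime σ j ≤ a := by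
      unfold orbitNode at hai
      split_ifs at hai with h0
      rcases hq : (σ ^ a) (Sum.inr j) with q | q
      · simp [hq, rowNode] at hai
      · exact returnTime_le σ (by omega) hq
    rw [← hai, ← hlast, show a = returnTime σ j by omega]

end

/-- A nonzero term of the Leibniz expansion of the determinant belongs to a permutation whose cycles
through the output indices, cut at these indices, are the paths of a linking. -/
theorem exists_isLinking_of_det_ne_zero {Λ : S.Param → ℝ} {J : Fin p → Fin m}
    (h : (systemPencil (S.matA Λ) (S.matB Λ) (S.matC Λ) J).det ≠ 0) :
    ∃ L : Finset (List (Node n m p)),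
      IsLinking S.graph (Set.range Node.u) (Set.range Node.y) L ∧ L.card = p := by
  classical
  have hJ : Function.Injective J := by
    intro i j hij
    by_contra hne
    refine h (Matrix.det_zero_of_column_eq (i := Sum.inr i) (j := Sum.inr j)
      (fun h => hne (Sum.inr_injective h)) ?_)
    rintro (k | k) <;> simp [systemPencil, systemMatrix, hij]
  rw [Matrix.det_apply] at h
  obtain ⟨σ, -, hσ⟩ := Finset.exists_ne_zero_of_sum_ne_zero h
  have hσ : ∀ c, systemPencil (S.matA Λ) (S.matB Λ) (S.matC Λ) J (σ c) c ≠ 0 := by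
    intro c hc
    have h0 : ∏ i, systemPencil (S.matA Λ) (S.matB Λ) (S.matC Λ) J (σ i) i = 0 :=
      Finset.prod_eq_zero (Finset.mem_univ c) hc
    exact hσ (by rw [h0, smul_zero])
  let path : Fin p → List (Node n m p) := fun j =>
    (List.range (returnTime σ j + 1)).map (orbitNode σ J j)
  have hpath : ∀ i j w, w ∈ path i → w ∈ path j → i = j := by
    intro i j w hi hj
    obtain ⟨a, ha, rfl⟩ := List.mem_map.1 hi
    obtain ⟨b, hb, hab⟩ := List.mem_map.1 hj
    rw [List.mem_range] at ha hb
    exact (orbitNode_inj hJ (by omega) (by omega) hab.symm).1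
  refine ⟨Finset.univ.image path, ⟨?_, ?_⟩, ?_⟩
  · intro l hl
    obtain ⟨j, -, rfl⟩ := Finset.mem_image.1 hl
    exact isSimpleDirectPath_orbit hJ hσ j
  · intro l hl l' hl' hne w hw hw'
    obtain ⟨i, -, rfl⟩ := Finset.mem_image.1 hl
    obtain ⟨j, -, rfl⟩ := Finset.mem_image.1 hl'
    exact hne (congrArg path (hpath i j w hw hw'))
  · rw [Finset.card_image_of_injective, Finset.card_univ, Fintype.card_fin]
    intro i j hij
    have hmem : orbitNode σ J i 0 ∈ path i := List.mem_map.2 ⟨0, by simp, rfl⟩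
    exact hpath i j _ hmem (hij ▸ hmem)

theorem exists_isLinking_of_genericallyFOC (h : S.GenericallyFOC) :
    ∃ L : Finset (List (Node n m p)),
      IsLinking S.graph (Set.range Node.u) (Set.range Node.y) L ∧ L.card = p := by
  obtain ⟨_, ⟨F, ⟨f, hf⟩, hne, rfl⟩, hfoc⟩ := h
  obtain ⟨Λ, hΛ⟩ : ∃ Λ, MvPolynomial.eval Λ f ≠ 0 := by
    by_contra! hcon
    exact hne f hf (MvPolynomial.funext fun Λ => by rw [hcon, map_zero])
  obtain ⟨J, hJ⟩ := exists_det_ne_zero_of_functionallyOutputControllable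
    (hfoc Λ fun hmem => hΛ (hmem f hf))
  exact exists_isLinking_of_det_ne_zero hJ

end

end StructuredSystems

theorem corollary1 {n m p : ℕ} (S : StructuredSystems.StructuredSystem n m p) :
    S.GenericallyFOC ↔
      ∃ L : Finset (List (StructuredSystems.Node n m p)),
        S.IsMaximumInputOutputLinking L ∧ L.card = p := by
  constructor
  · intro h
    obtain ⟨L, hL, hcard⟩ := StructuredSystems.exists_isLinking_of_genericallyFOC h
    exact ⟨L, ⟨hL, fun L' hL' =>
      (StructuredSystems.card_le_of_isLinking hL').trans hcard.ge⟩, hcard⟩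
  · rintro ⟨L, ⟨hL, -⟩, hcard⟩
    exact StructuredSystems.genericallyFOC_of_isLinking hL hcard
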